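/- \textbf{Setting.} $N$ is a finite set of students, $M$ a finite set of colleges and $F=\{f_1,f_2\}$ a set of two features. An instance consists of a capacity $x_c\ge 1$ and a strict total order $\succ_c$ on $N$ for each college $c$, utility functions $u_s^f:M\to[0,1]$ for each student $s$ and feature $f$, and for each student $s$ a probability distribution $\mu_s$ of her weight vector $w_s$ on $\{w\in\mathbb{R}^F: w^f\ge 0,\ \sum_f w^f=1\}$. With weights $w$, student $s$ strictly prefers $c$ to $c'$ if $\sum_f w^f u_s^f(c)>\sum_f w^f u_s^f(c')$, and weakly if $\ge$ holds; every college is strictly better than being unmatched. GDA (generalized student-proposing deferred acceptance): let $R_s$ be the set of colleges that have rejected $s$, initially empty. In each round, every unmatched student $s$ with $R_s\ne M$ proposes to the college $\mathsf{Next}(s,R_s,u_s,\mu_s)\in M\setminus R_s$; every college $c$ keeps its $x_c$ most preferred students (all, if there are at most $x_c$) among those it holds and those who have just proposed to it, and rejects the others. The procedure stops when every unmatched student has been rejected by all colleges. HEUF: $\mathsf{Next}$ returns a college of largest expected utility $\mathbb{E}_{w\sim\mu_s}[\sum_f w^f u_s^f(c)]$ among $c\notin R_s$. LOICV: $\mathsf{Next}$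 returns a college $c\notin R_s$ for which the vector of the probabilities $\Pr[c \text{ is weakly preferred to } c']$, $c'\in M\setminus R_s$, $c'\ne c$, arranged in ascending order, is lexicographically largest. In both methods ties are broken by an arbitrary rule that is a function of the arguments of $\mathsf{Next}$; the statement is about each such rule (so also about each realization of a random one). Fix weight distributions $\mu=(\mu_s)_{s\in N}$, write $e_s=\mathbb{E}[w_s^{f_1}]$, and let $\mathcal{I}(\mu)$ be the set of all instances with these weight distributions (capacities, college preferences and utilities being arbitrary). An algorithm is \emph{IC-R on $\mathcal{I}(\mu)$} if in no instance of $\mathcal{I}(\mu)$ a student $s$, by reporting some utilities $u'_s$ and some weight distribution $\mu'_s$ instead of $u_s,\mu_s$, obtains an assignment that she strictly prefers, with probability larger than $1/2$ under $\mu_s$, to the one she obtains by reporting truthfully. A number $m$ is a \emph{median} of $w_s^{f_1}$ if $\Pr[w_s^{f_1}\ge m]\ge\frac12$ and $\Pr[w_s^{f_1}\le m]\ge\frac12$. \textbf{Theorem.} Let $|F|=2$. (a) Suppose $\Pr[w_s^{f_1}=e_s]=0$ for every $s\in N$ (for instance, all distributions are continuous) and $|M|\ge 2$. Then GDA with the HEUF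 rule is IC-R on $\mathcal{I}(\mu)$ if and only if $$\Pr[w_s^{f_1}\ge e_s]=\Pr[w_s^{f_1}\le e_s]\quad\text{for every } s\in N. \tag{$*$}$$ (b) For arbitrary weight distributions, $(*)$ implies that GDA with the HEUF rule is IC-R on $\mathcal{I}(\mu)$. (c) For arbitrary weight distributions and $|M|\ge 2$, GDA with the HEUF rule is IC-R on $\mathcal{I}(\mu)$ if and only if, for every $s\in N$, the mean $e_s$ is a median of $w_s^{f_1}$. (d) Suppose that, for every $s\in N$, the mean $e_s$ is the unique median of $w_s^{f_1}$. (This holds under $(*)$ whenever $w_s^{f_1}$ has only one median.) Then HEUF and LOICV coincide up to tie-breaking: for every LOICV rule there is an HEUF rule that makes the same proposals for all students with the weight distributions $\mu$, for all utilities and all sets $R_s$, and GDA with the two rules has the same output on every instance of $\mathcal{I}(\mu)$; and for all HEUF and LOICV rules, whatever their tie-breaking, GDA has the same output on every instance of $\mathcal{I}(\mu)$ in which no student has two colleges of equal expected utility. -/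

import Mathlib

open MeasureTheory

namespace SchoolChoice

/-- Weight vectors: nonnegative weights on the features that sum to one. -/
abbrev WeightVec (F : Type*) [Fintype F] : Type _ := stdSimplex ℝ F

/-- Probability distributions over weight vectors. -/
abbrev WeightDist (F : Type*) [Fintype F] : Type _ := ProbabilityMeasure (WeightVec F)

/-- The utility functions of one student: `u f c` is her utility in `[0, 1]` of the college `c`
with respect to the feature `f`. -/
abbrev Utility (M F : Type*) : Type _ := F → M → Set.Icc (0 : ℝ) 1

/-- The probability of an event under a weight distribution. -/
noncomputable def Pr {F : Type*} [Fintype F] (ν : WeightDist F) (A : Set (WeightVec F)) : ℝ :=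
  (ν : Measure (WeightVec F)).real A

/-- An instance of school choice with feature-based uncertain preferences, with students `N`,
colleges `M` and features `F`. `prefers c s s'` says that `c` prefers `s` to `s'`. -/
structure Market (N M F : Type*) [Fintype F] where
  cap : M → ℕ
  cap_pos : ∀ c, 0 < cap c
  prefers : M → N → N → Prop
  prefers_strict : ∀ c, IsStrictTotalOrder N (prefers c)
  util : N → Utility M F
  weights : N → WeightDist F

/-- A matching, given by the assignment of the students (`none` for unmatched). -/
abbrev Matching (N M : Type*) : Type _ := N → Option M

section Preferences

variable {N M F : Type*} [Fintype F]

/-- The weighted utility of a college. -/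
noncomputable def weightedUtil (u : Utility M F) (w : WeightVec F) (c : M) : ℝ :=
  ∑ f, w.1 f * (u f c : ℝ)

/-- The expected weighted utility of a college. -/
noncomputable def expectedUtil (u : Utility M F) (ν : WeightDist F) (c : M) : ℝ :=
  ∫ w, weightedUtil u w c ∂(ν : Measure (WeightVec F))

/-- `Better u w x y`: with the weights `w`, the assignment `x` is strictly better than `y`. Every
college is acceptable, that is, strictly better than being unmatched. -/
def Better (u : Utility M F) (w : WeightVec F) : Option M → Option M → Prop
  | some c, some c' => weightedUtil u w c' < weightedUtil u w c
  | some _, none => True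
  | none, _ => False

/-- The probability that the college `c` is weakly preferred to the college `c'`. -/
noncomputable def prWeakly (u : Utility M F) (ν : WeightDist F) (c c' : M) : ℝ :=
  Pr ν {w | weightedUtil u w c' ≤ weightedUtil u w c}

end Preferences

section Algorithm

variable {N M F : Type*} [Fintype N] [Fintype M] [Fintype F]

/-- A function `Next`: it names the college to which a student `s` proposes next, given the set of
colleges that have rejected her and her (reported) utilities and weight distribution. Ties are
broken by the function itself. -/
abbrev NextFn (N M F : Type*) [Fintype F] : Type _ :=
  N → Finset M → Utility M F → WeightDist F → M

/-- The state of generalized deferred acceptance: the current matching, and for each student the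
set of colleges that have rejected her. -/
structure State (N M : Type*) where
  assign : Matching N M
  rejected : N → Finset M

/-- The loop condition: some unmatched student has not been rejected by all colleges. -/
def Active (st : State N M) : Prop :=
  ∃ s, st.assign s = none ∧ st.rejected s ≠ Finset.univ

open Classical in
/-- The college to which `s` proposes in the current round, if any. -/
noncomputable def proposal (I : Market N M F) (next : NextFn N M F) (st : State N M) (s : N) :
    Option M :=
  if st.assign s = none ∧ st.rejected s ≠ Finset.univ then
    some (next s (st.rejected s) (I.util s) (I.weights s))
  else none

/-- The college that holds `s` or has just received a proposal from `s`, if any. -/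
noncomputable def target (I : Market N M F) (next : NextFn N M F) (st : State N M) (s : N) :
    Option M :=
  (st.assign s).orElse fun _ => proposal I next st s

open Classical in
/-- Among the students that it holds or that have just proposed to it, the college `c` keeps the
`cap c` most preferred ones (all of them if there are at most `cap c`): those for whom fewer than
`cap c` of the candidates are preferred to them. -/
def Keeps (I : Market N M F) (next : NextFn N M F) (st : State N M) (c : M) (s : N) : Prop :=
  target I next st s = some c ∧
    (Finset.univ.filter fun s' => target I next st s' = some c ∧ I.prefers c s' s).card < I.cap c

open Classical in
/-- One round of proposals, acceptances and rejections. -/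
noncomputable def round (I : Market N M F) (next : NextFn N M F) (st : State N M) : State N M where
  assign s := (target I next st s).filter fun c => Keeps I next st c s
  rejected s := st.rejected s ∪
    Finset.univ.filter fun c => target I next st s = some c ∧ ¬ Keeps I next st c s

/-- The initial state. -/
def start (N M : Type*) : State N M where
  assign _ := none
  rejected _ := ∅

open Classical in
/-- The state after `k` passes of the while loop. -/
noncomputable def run (I : Market N M F) (next : NextFn N M F) : ℕ → State N M
  | 0 => start N M
  | k + 1 => if Active (run I next k) then round I next (run I next k) else run I next k

/-- Generalized student-proposing deferred acceptance. The loop stops after at most `|N| * |M|`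
rounds (`run_not_active`). -/
noncomputable def gda (next : NextFn N M F) (I : Market N M F) : Matching N M :=
  (run I next (Fintype.card N * Fintype.card M)).assign

/-- For a function `Next` that never repeats a college that has rejected the student, the loop
condition fails after `|N| * |M|` passes, so that `gda` is the output of the while loop. -/
theorem run_not_active (I : Market N M F) (next : NextFn N M F)
    (hnext : ∀ s R u ν, R ≠ Finset.univ → next s R u ν ∉ R) :
    ¬ Active (run I next (Fintype.card N * Fintype.card M)) := by
  classical
  let φ : State N M → N → ℕ := fun st s =>
    (st.rejected s).card + if st.assign s = none then 0 else 1
  let Inv : State N M → Prop := fun st => ∀ s c, st.assign s = some c → c ∉ st.rejected s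
  have hround : ∀ st, Inv st → Inv (round I next st) ∧
      ∀ s, φ (round I next st) s =
        φ st s + if st.assign s = none ∧ st.rejected s ≠ Finset.univ then 1 else 0 := by
    intro st hst
    have key : ∀ s, (∀ c, (round I next st).assign s = some c →
        c ∉ (round I next st).rejected s) ∧ φ (round I next st) s =
        φ st s + if st.assign s = none ∧ st.rejected s ≠ Finset.univ then 1 else 0 := by
      intro s
      have hT : ∀ c, target I next st s = some c → c ∉ st.rejected s := by
        intro c hc
        rcases h : st.assign s with _ | d
        · simp only [target, h, proposal, Option.orElse_none, true_and] at hc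
          split_ifs at hc with hR
          have := hnext s _ (I.util s) (I.weights s) hR
          simp only [Option.some.injEq] at hc
          rwa [← hc]
        · simp only [target, h, Option.orElse_some, Option.some.injEq] at hc
          exact hc ▸ hst s d h
      rcases h : target I next st s with _ | c
      · have ha : st.assign s = none ∧ ¬ (st.rejected s ≠ Finset.univ) := by
          rcases h' : st.assign s with _ | d
          · refine ⟨rfl, fun hR => ?_⟩
            simp [target, h', proposal, hR] at h
          · simp [target, h'] at h
        refine ⟨fun c hc => by simp [round, h] at hc, ?_⟩
        simp only [φ, round, h]
        simp [ha.1, not_not.1 ha.2]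
      · have hc := hT c h
        have hφ : φ st s + (if st.assign s = none ∧ st.rejected s ≠ Finset.univ then 1 else 0)
            = (st.rejected s).card + 1 := by
          rcases h' : st.assign s with _ | d
          · have : st.rejected s ≠ Finset.univ := fun hR => hc (hR ▸ Finset.mem_univ c)
            simp [φ, h', this]
          · simp [φ, h']
        rw [hφ]
        by_cases hk : Keeps I next st c s
        · have hr : (round I next st).rejected s = st.rejected s := by
            ext d
            simp only [round, h, Finset.mem_union, Finset.mem_filter, Finset.mem_univ, true_and,
              Option.some.injEq, or_iff_left_iff_imp]
            rintro ⟨rfl, hd⟩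
            exact absurd hk hd
          have hs : (round I next st).assign s = some c := by simp [round, h, hk]
          refine ⟨fun d hd => ?_, by simp [φ, hr, hs]⟩
          rw [hs, Option.some.injEq] at hd
          rw [hr, ← hd]
          exact hc
        · have hr : (round I next st).rejected s = insert c (st.rejected s) := by
            ext d
            simp only [round, h, Finset.mem_union, Finset.mem_filter, Finset.mem_univ, true_and,
              Option.some.injEq, Finset.mem_insert]
            constructor
            · rintro (hd | ⟨rfl, -⟩)
              · exact Or.inr hd
              · exact Or.inl rfl
            · rintro (rfl | hd)
              · exact Or.inr ⟨rfl, hk⟩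
              · exact Or.inl hd
          have hs : (round I next st).assign s = none := by simp [round, h, hk]
          refine ⟨fun d hd => by simp [hs] at hd, ?_⟩
          simp [φ, hr, hs, Finset.card_insert_of_notMem hc]
    exact ⟨fun s => (key s).1, fun s => (key s).2⟩
  have hrun : ∀ k, Inv (run I next k) ∧
      (Active (run I next k) → k ≤ ∑ s, φ (run I next k) s) := by
    intro k
    induction k with
    | zero => exact ⟨fun s c h => by simp [run, start] at h, fun _ => Nat.zero_le _⟩
    | succ k ih =>
      by_cases hA : Active (run I next k)
      · obtain ⟨h1, h2⟩ := hround _ ih.1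
        simp only [run, hA, if_true]
        refine ⟨h1, fun _ => ?_⟩
        have h3 := ih.2 hA
        obtain ⟨s, hs⟩ := hA
        have : ∑ s, φ (run I next k) s < ∑ s, φ (round I next (run I next k)) s :=
          Finset.sum_lt_sum (fun i _ => by rw [h2 i]; exact Nat.le_add_right _ _)
            ⟨s, Finset.mem_univ s, by rw [h2 s, if_pos hs]; exact Nat.lt_succ_self _⟩
        omega
      · simp only [run, hA, if_false]
        exact ⟨ih.1, fun h => h.elim⟩
  intro hA
  obtain ⟨h1, h2⟩ := hrun (Fintype.card N * Fintype.card M)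
  have h3 := h2 hA
  obtain ⟨s, hs, hs'⟩ := hA
  have hle : ∀ s, φ (run I next (Fintype.card N * Fintype.card M)) s ≤ Fintype.card M := by
    intro s
    rcases h : (run I next (Fintype.card N * Fintype.card M)).assign s with _ | c
    · simpa [φ, h] using Finset.card_le_univ _
    · have := Finset.card_lt_univ_of_notMem (h1 s c h)
      simp only [φ, h]
      simpa using this
  have hlt : ∑ s, φ (run I next (Fintype.card N * Fintype.card M)) s
      < ∑ _s : N, Fintype.card M := by
    refine Finset.sum_lt_sum (fun i _ => hle i) ⟨s, Finset.mem_univ s, ?_⟩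
    have : ((run I next (Fintype.card N * Fintype.card M)).rejected s).card
        < Fintype.card M := (Finset.card_lt_iff_ne_univ _).2 hs'
    simpa [φ, hs] using this
  simp only [Finset.sum_const, Finset.card_univ, smul_eq_mul] at hlt
  omega

/-- Higher Expected Utility First, with an arbitrary tie-breaking: the next college has the largest
expected utility among those that have not rejected the student. -/
def IsHEUF (next : NextFn N M F) : Prop :=
  ∀ s R u ν, R ≠ Finset.univ →
    next s R u ν ∉ R ∧ ∀ c, c ∉ R → expectedUtil u ν c ≤ expectedUtil u ν (next s R u ν)

open Classical in
/-- The iterated comparison vector of `c` given the set `R` of colleges that have rejected the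
student: the probabilities that `c` is weakly preferred to `c'`, for the other colleges `c'`
outside `R`, in ascending order. -/
noncomputable def comparisonVec (u : Utility M F) (ν : WeightDist F) (R : Finset M) (c : M) :
    List ℝ :=
  (((Finset.univ \ R).erase c).val.map fun c' => prWeakly u ν c c').sort (· ≤ ·)

/-- Lexicographic Order of Iterated Comparison Vectors, with an arbitrary tie-breaking: the
iterated comparison vector of the next college is lexicographically largest among the colleges that
have not rejected the student. (`<` on lists is the lexicographic order.) -/
def IsLOICV (next : NextFn N M F) : Prop :=
  ∀ s R u ν, R ≠ Finset.univ →
    next s R u ν ∉ R ∧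
      ∀ c, c ∉ R → ¬ comparisonVec u ν R (next s R u ν) < comparisonVec u ν R c

end Algorithm

section Incentives

variable {N M F : Type*} [Fintype F]

open Classical in
/-- The instance in which the student `s` reports `u'` and `ν'`. -/
noncomputable def Market.misreport (I : Market N M F) (s : N) (u' : Utility M F)
    (ν' : WeightDist F) : Market N M F :=
  { I with
    util := Function.update I.util s u'
    weights := Function.update I.weights s ν' }

/-- Incentive compatibility with rationality on a class `𝒞` of instances: in no instance of `𝒞` can
a student, by an arbitrary misreport, obtain an assignment that is better than her truthful one
with probability larger than `1/2`. -/
def ICROn (𝒞 : Set (Market N M F)) (alg : Market N M F → Matching N M) : Prop :=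
  ∀ I ∈ 𝒞, ∀ (s : N) (u' : Utility M F) (ν' : WeightDist F),
    ¬ 1 / 2 < Pr (I.weights s) {w | Better (I.util s) w (alg (I.misreport s u' ν') s) (alg I s)}

/-- The instances in which the weight distributions of the students are given by `μ`; capacities,
preferences of colleges and utilities are arbitrary. -/
def withWeights (μ : N → WeightDist F) : Set (Market N M F) := {I | I.weights = μ}

end Incentives

section Weights

variable {F : Type*} [Fintype F]

/-- The mean of the weight of the feature `f`. -/
noncomputable def meanWeight (f : F) (ν : WeightDist F) : ℝ :=
  ∫ w, w.1 f ∂(ν : Measure (WeightVec F))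

/-- The weight of `f` is at least its mean with the same probability as it is at most its mean. -/
def Balanced (f : F) (ν : WeightDist F) : Prop :=
  Pr ν {w | meanWeight f ν ≤ w.1 f} = Pr ν {w | w.1 f ≤ meanWeight f ν}

/-- `m` is a median of the weight of `f`. -/
def IsMedian (f : F) (ν : WeightDist F) (m : ℝ) : Prop :=
  1 / 2 ≤ Pr ν {w | m ≤ w.1 f} ∧ 1 / 2 ≤ Pr ν {w | w.1 f ≤ m}

end Weights

end SchoolChoice

/-! With two features, the utility of a college is an affine function of the weight `t` of `f₁`, and
its expected utility is the value of that function at the mean `e` (`exists_affine`). Ranking by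
expected utility thus compares lines at `e`. The line that is higher there is weakly higher on a
closed half-line ending at `e`, which has probability at least 1/2 if `e` is a median.

Sufficiency: the report of a student fixes the order of her proposals, so GDA is ordinary deferred
acceptance. This is strategy-proof (`not_rejected_of_misreport`, by `blocking_lemma`): a misreport
yields no larger expected utility, hence nothing that is better with probability above 1/2.

Necessity: if `t < e` has probability above 1/2, then so has `t < z` for some `z < e`. Let one
college be worth `t` and another constantly `z`, with ample capacities. HEUF picks the first,
although the second is better with probability above 1/2 and can be had by a misreport. Exchanging
the features gives the other inequality.

The criterion `Balanced` reduces to medians by inclusion-exclusion. For LOICV with a unique median,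
the smallest comparison probability is at least 1/2 for a college of largest expected utility and
below 1/2 for the others, so the first entries of the vectors already decide. -/

namespace SchoolChoice

/-! ### Counting in strict total orders, and the proposal order defined by a rule -/

section Ranking

variable {N M F : Type*}

open Classical in
theorem card_preceding_lt {lt : N → N → Prop} (hlt : IsStrictTotalOrder N lt) {T : Finset N}
    {x z : N} (hx : x ∈ T) (hxz : lt x z) :
    (T.filter fun y => lt y x).card < (T.filter fun y => lt y z).card := by
  refine Finset.card_lt_card ((Finset.ssubset_iff_of_subset ?_).2 ⟨x, ?_, ?_⟩)
  · intro y hy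
    simp only [Finset.mem_filter] at hy ⊢
    exact ⟨hy.1, _root_.trans hy.2 hxz⟩
  · simp [hx, hxz]
  · simp [irrefl_of lt x]

open Classical in
theorem injOn_card_preceding {lt : N → N → Prop} (hlt : IsStrictTotalOrder N lt) (T : Finset N) :
    Set.InjOn (fun x => (T.filter fun y => lt y x).card) T := by
  intro x hx y hy hxy
  rcases trichotomous_of lt x y with h | h | h
  · exact absurd hxy (card_preceding_lt hlt hx h).ne
  · exact h
  · exact absurd hxy (card_preceding_lt hlt hy h).ne'

open Classical in
/-- If at least `n` elements of `T` precede `s` in a strict total order, then so do at least `n` of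
those elements of `T` that fewer than `n` elements of `T` precede. -/
theorem le_card_filter_top {lt : N → N → Prop} (hlt : IsStrictTotalOrder N lt) (T : Finset N)
    (n : ℕ) (s : N) (h : n ≤ (T.filter fun x => lt x s).card) :
    n ≤ (T.filter fun x => (T.filter fun y => lt y x).card < n ∧ lt x s).card := by
  set U := T.filter fun x => lt x s with hU
  set ρ : N → ℕ := fun x => (T.filter fun y => lt y x).card with hρ
  have hinj : Set.InjOn ρ U := (injOn_card_preceding hlt T).mono (Finset.filter_subset _ _)
  -- By transitivity, `ρ` is below `U.card` on `U`; being injective, it takes each value `0, …,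
  -- U.card - 1` once. The elements with the values below `n` are those sought.
  have himg : U.image ρ = Finset.range U.card := by
    refine Finset.eq_of_subset_of_card_le ?_ ?_
    · intro k hk
      obtain ⟨x, hx, rfl⟩ := Finset.mem_image.1 hk
      have hx' := Finset.mem_filter.1 hx
      exact Finset.mem_range.2 (card_preceding_lt hlt hx'.1 hx'.2)
    · rw [Finset.card_range, Finset.card_image_of_injOn hinj]
  have hsub : Finset.range n ⊆ (T.filter fun x => ρ x < n ∧ lt x s).image ρ := by
    intro k hk
    have hk' : k ∈ U.image ρ := by
      rw [himg]
      exact Finset.mem_range.2 ((Finset.mem_range.1 hk).trans_le h)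
    obtain ⟨x, hx, rfl⟩ := Finset.mem_image.1 hk'
    have hx' := Finset.mem_filter.1 hx
    exact Finset.mem_image_of_mem _
      (Finset.mem_filter.2 ⟨hx'.1, Finset.mem_range.1 hk, hx'.2⟩)
  calc n = (Finset.range n).card := (Finset.card_range n).symm
    _ ≤ _ := Finset.card_le_card hsub
    _ ≤ _ := Finset.card_image_le

open Classical in
/-- At most `n` elements of `T` are preceded by fewer than `n` elements of `T`. -/
theorem card_filter_top_le {lt : N → N → Prop} (hlt : IsStrictTotalOrder N lt) (T : Finset N)
    (n : ℕ) : (T.filter fun x => (T.filter fun y => lt y x).card < n).card ≤ n := by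
  refine (Finset.card_le_card_of_injOn (t := Finset.range n) _ (fun x hx => ?_)
    ((injOn_card_preceding hlt T).mono (Finset.filter_subset _ _))).trans_eq (Finset.card_range n)
  exact Finset.mem_coe.2 (Finset.mem_range.2 (Finset.mem_filter.1 hx).2)

open Classical in
/-- The sets of the first `k` colleges named by `f` when each named college rejects. -/
noncomputable def chain (f : Finset M → M) : ℕ → Finset M
  | 0 => ∅
  | k + 1 => insert (f (chain f k)) (chain f k)

/-- The position of `c` in the sequence of colleges named by `f`. -/
noncomputable def rank (f : Finset M → M) (c : M) : ℕ := sInf {k | c ∈ chain f (k + 1)}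

theorem chain_mono (f : Finset M → M) : Monotone (chain f) :=
  monotone_nat_of_le_succ fun k => by
    classical
    exact Finset.subset_insert _ _

variable [Fintype M]

theorem exists_mem_chain (f : Finset M → M) (hf : ∀ R, R ≠ Finset.univ → f R ∉ R) (c : M) :
    ∃ k, c ∈ chain f (k + 1) := by
  classical
  -- The chain gains one college per step until it is everything, so after `|M| + 1` steps the
  -- second alternative is impossible.
  have h : ∀ k, chain f k = Finset.univ ∨ (chain f k).card = k := by
    intro k
    induction k with
    | zero => exact Or.inr rfl
    | succ k ih =>
      by_cases hk : chain f k = Finset.univ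
      · exact Or.inl (Finset.univ_subset_iff.1 (hk ▸ chain_mono f k.le_succ))
      · refine Or.inr ?_
        rw [chain, Finset.card_insert_of_notMem (hf _ hk), ih.resolve_left hk]
  refine ⟨Fintype.card M, ?_⟩
  rcases h (Fintype.card M + 1) with h | h
  · simp [h]
  · have := Finset.card_le_univ (chain f (Fintype.card M + 1))
    omega

theorem mem_chain_iff (f : Finset M → M) (hf : ∀ R, R ≠ Finset.univ → f R ∉ R) (c : M) (k : ℕ) :
    c ∈ chain f k ↔ rank f c < k := by
  have hne : {k | c ∈ chain f (k + 1)}.Nonempty := exists_mem_chain f hf c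
  constructor
  · intro h
    cases k with
    | zero => simp [chain] at h
    | succ k => exact Nat.lt_succ_of_le (Nat.sInf_le h)
  · intro h
    exact chain_mono f (Nat.succ_le_of_lt h) (Nat.sInf_mem hne)

theorem rank_apply_chain (f : Finset M → M) (hf : ∀ R, R ≠ Finset.univ → f R ∉ R) (k : ℕ)
    (hk : chain f k ≠ Finset.univ) : rank f (f (chain f k)) = k := by
  classical
  have h1 := hf _ hk
  rw [mem_chain_iff f hf] at h1
  have h2 : f (chain f k) ∈ chain f (k + 1) := Finset.mem_insert_self _ _
  rw [mem_chain_iff f hf] at h2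
  omega

theorem apply_chain_rank (f : Finset M → M) (hf : ∀ R, R ≠ Finset.univ → f R ∉ R) (c : M) :
    f (chain f (rank f c)) = c := by
  classical
  have h1 : c ∈ chain f (rank f c + 1) := (mem_chain_iff f hf _ _).2 (Nat.lt_succ_self _)
  have h2 : c ∉ chain f (rank f c) := fun h => lt_irrefl _ ((mem_chain_iff f hf _ _).1 h)
  exact ((Finset.mem_insert.1 h1).resolve_right h2).symm

theorem rank_injective (f : Finset M → M) (hf : ∀ R, R ≠ Finset.univ → f R ∉ R) :
    Function.Injective (rank f) := fun c d h => by
  rw [← apply_chain_rank f hf c, h, apply_chain_rank f hf d]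

end Ranking

/-! ### Invariants of deferred acceptance, the blocking lemma and strategy-proofness -/

section DeferredAcceptance

variable {N M F : Type*} [Fintype N] [Fintype M] [Fintype F]

/-- The position of a college in the order in which a student would propose. -/
noncomputable def proposalRank (I : Market N M F) (next : NextFn N M F) (s : N) : M → ℕ :=
  rank fun R => next s R (I.util s) (I.weights s)

/-- `next` never names a college that has rejected the student. -/
def NonRepeating (next : NextFn N M F) : Prop :=
  ∀ s R u ν, R ≠ Finset.univ → next s R u ν ∉ R

/-- The properties of the states that occur in deferred acceptance: a student has been rejected by
an initial segment of her proposal order, and proposes to, or is held by, the college that follows;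
no college is over capacity, and a college holds enough students preferred to each rejected one. -/
structure Valid (I : Market N M F) (next : NextFn N M F) (st : State N M) : Prop where
  segment : ∀ s, ∃ k, (∀ c, c ∈ st.rejected s ↔ proposalRank I next s c < k) ∧
    ∀ c, st.assign s = some c → proposalRank I next s c = k
  card_le : ∀ c (B : Finset N), (∀ s ∈ B, st.assign s = some c) → B.card ≤ I.cap c
  full : ∀ s c, c ∈ st.rejected s →
    ∃ B : Finset N, (∀ x ∈ B, st.assign x = some c ∧ I.prefers c x s) ∧ I.cap c ≤ B.card

variable {I : Market N M F} {next : NextFn N M F} {st : State N M}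

omit [Fintype N] in
theorem target_of_assign {s : N} {c : M} (h : st.assign s = some c) :
    target I next st s = some c := by
  simp [target, h]

-- The set of rejections is the initial segment `chain k`, and the rule applied to it names the
-- college of rank `k`. Hence a new proposal has the same position as a held college.
omit [Fintype N] in
theorem Valid.segment_target (hn : NonRepeating next) (hv : Valid I next st) (s : N) :
    ∃ k, (∀ c, c ∈ st.rejected s ↔ proposalRank I next s c < k) ∧
      ∀ c, target I next st s = some c → proposalRank I next s c = k := by
  obtain ⟨k, hk, hk'⟩ := hv.segment s
  refine ⟨k, hk, fun c hc => ?_⟩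
  rcases h : st.assign s with _ | d
  · simp only [target, h, proposal, Option.orElse_none, true_and] at hc
    split_ifs at hc with hR
    have hch : st.rejected s = chain (fun R => next s R (I.util s) (I.weights s)) k := by
      ext c
      rw [hk, proposalRank, mem_chain_iff _ fun R hR => hn s R _ _ hR]
    simp only [Option.some.injEq] at hc
    rw [hch] at hR hc
    rw [← hc]
    exact rank_apply_chain _ (fun R hR => hn s R _ _ hR) k hR.2
  · rw [target_of_assign h, Option.some.injEq] at hc
    exact hc ▸ hk' d h

theorem round_assign {s : N} {c : M} :
    (round I next st).assign s = some c ↔ Keeps I next st c s := by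
  simp only [round, Option.filter_eq_some_iff, decide_eq_true_eq]
  exact ⟨fun h => h.2, fun h => ⟨h.1, h⟩⟩

theorem round_rejected {s : N} {c : M} :
    c ∈ (round I next st).rejected s ↔
      c ∈ st.rejected s ∨ target I next st s = some c ∧ ¬ Keeps I next st c s := by
  simp [round]

theorem Valid.round (hn : NonRepeating next) (hv : Valid I next st) :
    Valid I next (round I next st) := by
  classical
  have hinj : ∀ s, Function.Injective (proposalRank I next s) := fun s =>
    rank_injective _ fun R hR => hn s R _ _ hR
  refine ⟨fun s => ?_, fun c B hB => ?_, fun s c hc => ?_⟩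
  · obtain ⟨k, hk, hk'⟩ := hv.segment_target hn s
    by_cases h : ∃ c, target I next st s = some c ∧ ¬ Keeps I next st c s
    · obtain ⟨c, hc, hc'⟩ := h
      refine ⟨k + 1, fun d => ?_, fun d hd => ?_⟩
      · rw [round_rejected, hk, Nat.lt_succ_iff_lt_or_eq]
        refine or_congr_right ⟨fun hd => hk' d hd.1, fun hd => ?_⟩
        have : d = c := hinj s (hd.trans (hk' c hc).symm)
        exact this ▸ ⟨hc, hc'⟩
      · rw [round_assign] at hd
        have : d = c := Option.some_injective _ (hd.1.symm.trans hc)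
        exact absurd (this ▸ hd) hc'
    · push Not at h
      refine ⟨k, fun d => ?_, fun d hd => hk' d (round_assign.1 hd).1⟩
      rw [round_rejected, hk]
      exact or_iff_left fun hd => hd.2 (h d hd.1)
  · refine le_trans (Finset.card_le_card fun s hs => ?_) (card_filter_top_le (I.prefers_strict c)
      (Finset.univ.filter fun s => target I next st s = some c) (I.cap c))
    have := round_assign.1 (hB s hs)
    simpa [Keeps, Finset.filter_filter] using this
  · have key : I.cap c ≤ ((Finset.univ.filter fun s => target I next st s = some c).filter
        fun x => I.prefers c x s).card := by
      rcases round_rejected.1 hc with hc | hc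
      · obtain ⟨B, hB, hB'⟩ := hv.full s c hc
        refine hB'.trans (Finset.card_le_card fun x hx => ?_)
        simpa using ⟨target_of_assign (hB x hx).1, (hB x hx).2⟩
      · simpa [Keeps, hc.1, Finset.filter_filter] using hc.2
    refine ⟨_, fun x hx => ?_, le_card_filter_top (I.prefers_strict c) _ _ _ key⟩
    simp only [Finset.mem_filter, Finset.mem_univ, true_and, Finset.filter_filter] at hx
    exact ⟨round_assign.2 ⟨hx.1, hx.2.1⟩, hx.2.2⟩

theorem valid_run (hn : NonRepeating next) (k : ℕ) : Valid I next (run I next k) := by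
  induction k with
  | zero =>
    refine ⟨fun s => ⟨0, by simp [run, start], by simp [run, start]⟩, fun c B hB => ?_,
      by simp [run, start]⟩
    have : B = ∅ := Finset.eq_empty_of_forall_notMem fun s hs => by simpa [run, start] using hB s hs
    simp [this]
  | succ k ih =>
    rw [run]
    split_ifs
    exacts [ih.round hn, ih]

theorem rejected_run_mono (s : N) : Monotone fun k => (run I next k).rejected s :=
  monotone_nat_of_le_succ fun k => by
    rw [run]
    split_ifs
    · exact fun c hc => round_rejected.2 (Or.inl hc)
    · exact le_rfl

omit [Fintype N] [Fintype M] in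
/-- Every student who has been rejected by the college `c` is less preferred by `c` than
each student that it holds. -/
theorem Valid.prefers_of_rejected (hv : Valid I next st) {s b : N} {c : M}
    (hc : c ∈ st.rejected s) (hb : st.assign b = some c) : I.prefers c b s := by
  classical
  obtain ⟨B, hB, hB'⟩ := hv.full s c hc
  by_contra h
  have hbB : b ∉ B := fun hb' => h (hB b hb').2
  have := hv.card_le c (insert b B) fun x hx => by
    rcases Finset.mem_insert.1 hx with rfl | hx
    exacts [hb, (hB x hx).1]
  rw [Finset.card_insert_of_notMem hbB] at this
  omega

/-- The blocking lemma: if some students strictly prefer a feasible matching `m` to the outcome of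
deferred acceptance, then `m` is blocked by a pair whose student is not one of them. -/
theorem blocking_lemma (hn : NonRepeating next) (m : Matching N M)
    (hcap : ∀ c (B : Finset N), (∀ s ∈ B, m s = some c) → B.card ≤ I.cap c) {K : ℕ}
    (hne : ∃ a c, m a = some c ∧ c ∈ (run I next K).rejected a) :
    ∃ x c b, (∀ d, m x = some d → d ∉ (run I next K).rejected x) ∧
      (∀ d, m x = some d → proposalRank I next x c < proposalRank I next x d) ∧
      m b = some c ∧ I.prefers c x b := by
  classical
  by_contra hstable
  push Not at hstable
  have hinj : ∀ s, Function.Injective (proposalRank I next s) := fun s =>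
    rank_injective _ fun R hR => hn s R _ _ hR
  have hv := valid_run (I := I) hn K
  set μ := (run I next K).assign with hμ
  set A : Finset N := Finset.univ.filter fun a =>
    ∃ c, m a = some c ∧ c ∈ (run I next K).rejected a with hA
  have hmemA : ∀ a, a ∈ A ↔ ∃ c, m a = some c ∧ c ∈ (run I next K).rejected a := by simp [hA]
  have hnotA : ∀ x, x ∉ A → ∀ d, m x = some d → d ∉ (run I next K).rejected x :=
    fun x hx d hd hd' => hx ((hmemA x).2 ⟨d, hd, hd'⟩)
  -- If `m` sent such an `x` elsewhere, then `x` and `c` would block `m`, since `c` prefers everyone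
  -- it holds to the rejected `b`.
  have hfix : ∀ b c, m b = some c → c ∈ (run I next K).rejected b →
      ∀ x, μ x = some c → x ∉ A → m x = some c := by
    intro b c hb hc x hx hxA
    by_contra hmx
    refine hstable x c b (hnotA x hxA) (fun d hd => ?_) hb (hv.prefers_of_rejected hc hx)
    obtain ⟨k, hk, hk'⟩ := hv.segment x
    have h1 := hnotA x hxA d hd
    rw [hk, ← hk' c hx, not_lt] at h1
    refine lt_of_le_of_ne h1 fun h => hmx ?_
    rw [hd, hinj x h]
  set C : Finset (Option M) := A.image m
  -- The college is full under `μ` and not over capacity under `m`, and by `hfix` it has no fewer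
  -- students outside `A` under `m` than under `μ`.
  have hcount : ∀ o ∈ C, (A.filter fun a => m a = o).card ≤ (A.filter fun a => μ a = o).card := by
    intro o ho
    obtain ⟨b, hb, rfl⟩ := Finset.mem_image.1 ho
    obtain ⟨c, hbc, hc⟩ := (hmemA b).1 hb
    rw [hbc]
    have h1 : (Finset.univ.filter fun a => m a = some c).card ≤ I.cap c :=
      hcap c _ fun s hs => (Finset.mem_filter.1 hs).2
    have h2 : I.cap c ≤ (Finset.univ.filter fun a => μ a = some c).card := by
      obtain ⟨B, hB, hB'⟩ := hv.full b c hc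
      exact hB'.trans (Finset.card_le_card fun x hx => by simpa using (hB x hx).1)
    have h3 : ((Finset.univ.filter fun a => μ a = some c).filter (· ∉ A)).card ≤
        ((Finset.univ.filter fun a => m a = some c).filter (· ∉ A)).card := by
      refine Finset.card_le_card fun x hx => ?_
      simp only [Finset.mem_filter, Finset.mem_univ, true_and] at hx ⊢
      exact ⟨hfix b c hbc hc x hx.1 hx.2, hx.2⟩
    have e : ∀ g : N → Option M, A.filter (fun a => g a = some c) =
        (Finset.univ.filter fun a => g a = some c).filter (· ∈ A) := by
      intro g
      ext x
      simp [and_comm]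
    have h4 := Finset.card_filter_add_card_filter_not
      (s := Finset.univ.filter fun a => μ a = some c) (· ∈ A)
    have h5 := Finset.card_filter_add_card_filter_not
      (s := Finset.univ.filter fun a => m a = some c) (· ∈ A)
    rw [e, e]
    omega
  -- Summed over `C`, the left sides of `hcount` already give all of `A`, so `μ` sends no student of
  -- `A` outside `C`.
  have hAC : ∀ a ∈ A, μ a ∈ C := by
    have h1 : A.card = ∑ o ∈ C, (A.filter fun a => m a = o).card :=
      Finset.card_eq_sum_card_fiberwise fun a ha => Finset.mem_image_of_mem m ha
    have h2 : (A.filter fun a => μ a ∈ C).card = ∑ o ∈ C, (A.filter fun a => μ a = o).card := by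
      refine (Finset.card_eq_sum_card_fiberwise (f := μ) (t := C)
        fun a ha => (Finset.mem_filter.1 ha).2).trans ?_
      refine Finset.sum_congr rfl fun o ho => ?_
      congr 1
      ext a
      simp only [Finset.mem_filter]
      exact ⟨fun h => ⟨h.1.1, h.2⟩, fun h => ⟨⟨h.1, h.2 ▸ ho⟩, h.2⟩⟩
    have h3 : A.filter (fun a => μ a ∈ C) = A := by
      refine Finset.eq_of_subset_of_card_le (Finset.filter_subset _ _) ?_
      rw [h1, h2]
      exact Finset.sum_le_sum hcount
    exact fun a ha => Finset.filter_eq_self.1 h3 a ha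
  have hμA : ∀ a ∈ A, ∃ c b, μ a = some c ∧ b ∈ A ∧ m b = some c ∧
      c ∈ (run I next K).rejected b := by
    intro a ha
    obtain ⟨b, hb, hab⟩ := Finset.mem_image.1 (hAC a ha)
    obtain ⟨c, hbc, hc⟩ := (hmemA b).1 hb
    exact ⟨c, b, hab ▸ hbc, hb, hbc, hc⟩
  -- the first time at which all students of `A` have their final assignment
  have hex : ∃ t, ∀ a ∈ A, (run I next t).assign a = μ a := ⟨K, fun a _ => rfl⟩
  have hspec := Nat.find_spec hex
  have hle : Nat.find hex ≤ K := Nat.find_min' hex fun a _ => rfl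
  have hmin := fun t => Nat.find_min hex (m := t)
  generalize Nat.find hex = t at hspec hle hmin
  obtain ⟨a₀, c₀, h₀, h₀'⟩ := hne
  have ha₀ : a₀ ∈ A := (hmemA a₀).2 ⟨c₀, h₀, h₀'⟩
  cases t with
  | zero =>
    obtain ⟨c, b, hc, -⟩ := hμA a₀ ha₀
    have := hspec a₀ ha₀
    rw [hc] at this
    simp [run, start] at this
  | succ t =>
    have h := hmin t (Nat.lt_succ_self t)
    push Not at h
    obtain ⟨a, ha, hat⟩ := h
    have hact : Active (run I next t) := by
      by_contra hact
      refine hat ?_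
      rw [← hspec a ha, run, if_neg hact]
    have hrun : run I next (t + 1) = round I next (run I next t) := by rw [run, if_pos hact]
    obtain ⟨c, b, hac, hbA, hbc, hcb⟩ := hμA a ha
    have hvt := valid_run (I := I) hn t
    -- The final college of `b` is already her target in state `t`, so every college before it in
    -- her order, including `c`, has rejected her by then.
    have hcbt : c ∈ (run I next t).rejected b := by
      obtain ⟨d, -, hd, -⟩ := hμA b hbA
      have h1 := hspec b hbA
      rw [hd, hrun, round_assign] at h1
      obtain ⟨k, hk, hk'⟩ := hvt.segment_target hn b
      obtain ⟨l, hl, hl'⟩ := hv.segment b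
      rw [hk, ← hk' d h1.1]
      rw [hl, ← hl' d hd] at hcb
      exact hcb
    obtain ⟨B, hB, hBcard⟩ := hvt.full b c hcbt
    have haB : a ∉ B := fun h => hat ((hB a h).1.trans hac.symm)
    -- The newcomer `a` joins `c`, which was full with `B`, so `c` must drop someone. This `x` will
    -- be the student of the blocking pair.
    have hexx : ∃ x ∈ B, (run I next (t + 1)).assign x ≠ some c := by
      by_contra hall
      push Not at hall
      have := (valid_run (I := I) hn (t + 1)).card_le c (insert a B) fun x hx => by
        rcases Finset.mem_insert.1 hx with rfl | hx
        exacts [(hspec _ ha).trans hac, hall x hx]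
      rw [Finset.card_insert_of_notMem haB] at this
      omega
    obtain ⟨x, hxB, hx⟩ := hexx
    obtain ⟨hxc, hxb⟩ := hB x hxB
    have hxT : target I next (run I next t) x = some c := target_of_assign hxc
    have hxA : x ∉ A := by
      intro hxA
      obtain ⟨d, -, hd, -⟩ := hμA x hxA
      have h1 := hspec x hxA
      rw [hd] at h1
      have h2 := h1
      rw [hrun, round_assign] at h2
      rw [h2.1] at hxT
      exact hx (h1.trans hxT)
    have hcx : c ∈ (run I next K).rejected x := by
      refine rejected_run_mono x hle ?_
      rw [hrun] at hx
      change c ∈ (run I next (t + 1)).rejected x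
      rw [hrun, round_rejected]
      exact Or.inr ⟨hxT, fun h => hx (round_assign.2 h)⟩
    refine hstable x c b (hnotA x hxA) (fun d hd => ?_) hbc hxb
    have h1 := hnotA x hxA d hd
    obtain ⟨k, hk, -⟩ := hv.segment x
    rw [hk] at h1 hcx
    omega

/-- Deferred acceptance is strategy-proof: by a misreport, a student does not obtain a college that
has rejected her under truthful reports. -/
theorem not_rejected_of_misreport (hn : NonRepeating next) (s : N) (u' : Utility M F)
    (ν' : WeightDist F) {c : M} (hc : gda next (I.misreport s u' ν') s = some c) :
    c ∉ (run I next (Fintype.card N * Fintype.card M)).rejected s := by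
  classical
  intro hcr
  set I' := I.misreport s u' ν' with hI'
  have hv' := valid_run (I := I') hn (Fintype.card N * Fintype.card M)
  -- The outcome after the misreport would be blocked, under the true reports, by a student `x ≠ s`.
  -- Her report is unchanged, so `d` rejected her in that run, and `d` prefers `b` to her: a
  -- contradiction.
  obtain ⟨x, d, b, hx, hxd, hbd, hpref⟩ := blocking_lemma (I := I) hn (gda next I')
    hv'.card_le ⟨s, c, hc, hcr⟩
  have hxs : x ≠ s := by
    rintro rfl
    exact hx c hc hcr
  have hrank : proposalRank I' next x = proposalRank I next x := by
    simp [proposalRank, hI', Market.misreport, Function.update_of_ne hxs]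
  have hdx : d ∈ (run I' next (Fintype.card N * Fintype.card M)).rejected x := by
    rcases h : gda next I' x with _ | e
    · by_contra hd
      exact run_not_active I' next hn ⟨x, h, fun hu => hd (hu ▸ Finset.mem_univ d)⟩
    · obtain ⟨k, hk, hk'⟩ := hv'.segment x
      rw [hk, ← hk' e h, hrank]
      exact hxd e h
  have h1 : I.prefers d b x := hv'.prefers_of_rejected hdx hbd
  have := I.prefers_strict d
  exact asymm_of (I.prefers d) h1 hpref

end DeferredAcceptance

/-! ### Medians, affine utilities and pairwise comparison probabilities -/

section Weights

variable {M F : Type*} [Fintype F]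

theorem weight_nonneg (f : F) (w : WeightVec F) : 0 ≤ w.1 f := w.2.1 f

theorem weight_le_one (f : F) (w : WeightVec F) : w.1 f ≤ 1 := by
  rw [← w.2.2]
  exact Finset.single_le_sum (fun g _ => w.2.1 g) (Finset.mem_univ f)

theorem measurable_weight (f : F) : Measurable fun w : WeightVec F => w.1 f :=
  (measurable_pi_apply f).comp measurable_subtype_coe

theorem integrable_weight (f : F) (ν : WeightDist F) :
    Integrable (fun w : WeightVec F => w.1 f) (ν : Measure (WeightVec F)) :=
  Integrable.of_bound (measurable_weight f).aestronglyMeasurable 1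
    (Filter.Eventually.of_forall fun w => by
      rw [Real.norm_of_nonneg (weight_nonneg f w)]
      exact weight_le_one f w)

theorem Pr_mono (ν : WeightDist F) {A B : Set (WeightVec F)} (h : A ⊆ B) : Pr ν A ≤ Pr ν B :=
  measureReal_mono h

theorem Pr_not (ν : WeightDist F) {p : WeightVec F → Prop} (h : MeasurableSet {w | p w}) :
    Pr ν {w | ¬ p w} = 1 - Pr ν {w | p w} :=
  probReal_compl_eq_one_sub h

theorem Pr_lt (ν : WeightDist F) {g : WeightVec F → ℝ} (hg : Measurable g) (z : ℝ) :
    Pr ν {w | g w < z} = 1 - Pr ν {w | z ≤ g w} := by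
  rw [← Pr_not ν (measurableSet_le measurable_const hg)]
  simp only [not_le]

/-- Inclusion-exclusion. At the mean, equal probabilities are therefore both at least 1/2; without
an atom there, two probabilities of at least 1/2 must be equal. -/
theorem Pr_ge_add_Pr_le (ν : WeightDist F) {g : WeightVec F → ℝ} (hg : Measurable g) (z : ℝ) :
    Pr ν {w | z ≤ g w} + Pr ν {w | g w ≤ z} = 1 + Pr ν {w | g w = z} := by
  have h1 := measureReal_union_add_inter (μ := (ν : Measure (WeightVec F)))
    (s := {w | z ≤ g w}) (t := {w | g w ≤ z}) (measurableSet_le hg measurable_const)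
  have h2 : {w | z ≤ g w} ∪ {w | g w ≤ z} = Set.univ := by
    ext w
    simpa using le_total z (g w)
  have h3 : {w | z ≤ g w} ∩ {w | g w ≤ z} = {w | g w = z} := by
    ext w
    exact ⟨fun h => le_antisymm h.2 h.1, fun h => ⟨(show g w = z from h).ge,
      (show g w = z from h).le⟩⟩
  rw [h2, h3, probReal_univ] at h1
  exact h1.symm

theorem Balanced.isMedian {f : F} {ν : WeightDist F} (h : Balanced f ν) :
    IsMedian f ν (meanWeight f ν) := by
  have h1 := Pr_ge_add_Pr_le ν (measurable_weight f) (meanWeight f ν)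
  have h2 : 0 ≤ Pr ν {w | w.1 f = meanWeight f ν} := measureReal_nonneg
  rw [Balanced] at h
  constructor <;> linarith

theorem IsMedian.balanced {f : F} {ν : WeightDist F} (h : IsMedian f ν (meanWeight f ν))
    (h0 : Pr ν {w | w.1 f = meanWeight f ν} = 0) : Balanced f ν := by
  have h1 := Pr_ge_add_Pr_le ν (measurable_weight f) (meanWeight f ν)
  obtain ⟨h2, h3⟩ := h
  rw [Balanced]
  linarith

/-- An affine function of the weight that is nonnegative at a median is nonnegative with probability
at least `1 / 2`. -/
theorem IsMedian.half_le_Pr_affine {f : F} {ν : WeightDist F} {m : ℝ} (h : IsMedian f ν m)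
    {A B : ℝ} (hAB : 0 ≤ A + m * B) : 1 / 2 ≤ Pr ν {w | 0 ≤ A + w.1 f * B} := by
  rcases le_total 0 B with hB | hB
  · refine h.1.trans (Pr_mono ν fun w hw => ?_)
    have := mul_le_mul_of_nonneg_right (show m ≤ w.1 f from hw) hB
    simp only [Set.mem_ofPred_eq]
    linarith
  · refine h.2.trans (Pr_mono ν fun w hw => ?_)
    have := mul_le_mul_of_nonpos_right (show w.1 f ≤ m from hw) hB
    simp only [Set.mem_ofPred_eq]
    linarith

/-- An affine function of the weight that is positive at the unique median is nonpositive with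
probability less than `1 / 2`. -/
theorem Pr_affine_lt_half {f : F} {ν : WeightDist F} {m : ℝ} (h : ∀ z, IsMedian f ν z ↔ z = m)
    {A B : ℝ} (hAB : 0 < A + m * B) : Pr ν {w | A + w.1 f * B ≤ 0} < 1 / 2 := by
  by_contra hlt
  rw [not_lt] at hlt
  have hm := (h m).2 rfl
  rcases lt_trichotomy B 0 with hB | hB | hB
  -- The zero `-A / B` of the affine function would be a second median.
  · have hz : m < -A / B := by
      rw [lt_div_iff_of_neg hB]
      linarith
    refine hz.ne' ((h _).1 ⟨hlt.trans (Pr_mono ν fun w hw => ?_), hm.2.trans (Pr_mono ν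
      fun w hw => (show w.1 f ≤ m from hw).trans hz.le)⟩)
    simp only [Set.mem_ofPred_eq] at hw ⊢
    rw [div_le_iff_of_neg hB]
    linarith
  · have : {w : WeightVec F | A + w.1 f * B ≤ 0} = ∅ := by
      ext w
      simp only [hB, mul_zero, add_zero, Set.mem_ofPred_eq, Set.mem_empty_iff_false, iff_false,
        not_le] at hAB ⊢
      exact hAB
    rw [this, Pr, measureReal_empty] at hlt
    norm_num at hlt
  · have hz : -A / B < m := by
      rw [div_lt_iff₀ hB]
      linarith
    refine hz.ne ((h _).1 ⟨hm.1.trans (Pr_mono ν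
      fun w hw => hz.le.trans (show m ≤ w.1 f from hw)), hlt.trans (Pr_mono ν fun w hw => ?_)⟩)
    simp only [Set.mem_ofPred_eq] at hw ⊢
    rw [le_div_iff₀ hB]
    linarith

theorem exists_other_feature (hF : Fintype.card F = 2) (f : F) :
    ∃ g, g ≠ f ∧ ∀ a : F → ℝ, ∑ i, a i = a f + a g := by
  classical
  obtain ⟨x, y, hxy, hu⟩ := Finset.card_eq_two.1 ((Finset.card_univ (α := F)).trans hF)
  have hf : f ∈ ({x, y} : Finset F) := hu ▸ Finset.mem_univ f
  rw [hu]
  simp only [Finset.mem_insert, Finset.mem_singleton] at hf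
  rcases hf with rfl | rfl
  · exact ⟨y, hxy.symm, fun a => Finset.sum_pair hxy⟩
  · exact ⟨x, hxy, fun a => (Finset.sum_pair hxy).trans (add_comm _ _)⟩

/-- With two features, the utility of a college is an affine function of the weight of one. -/
theorem exists_affine (hF : Fintype.card F = 2) (f : F) (u : Utility M F) :
    ∃ α β : M → ℝ, (∀ w c, weightedUtil u w c = α c + w.1 f * β c) ∧
      ∀ ν c, expectedUtil u ν c = α c + meanWeight f ν * β c := by
  obtain ⟨g, -, hsum⟩ := exists_other_feature hF f
  have h : ∀ w c, weightedUtil u w c = (u g c : ℝ) + w.1 f * ((u f c : ℝ) - (u g c : ℝ)) := by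
    intro w c
    have h1 := w.2.2
    rw [hsum] at h1
    rw [weightedUtil, hsum, eq_sub_of_add_eq' h1]
    ring
  refine ⟨fun c => u g c, fun c => (u f c : ℝ) - (u g c : ℝ), h, fun ν c => ?_⟩
  simp only [expectedUtil, h, meanWeight]
  rw [integral_add (integrable_const _) ((integrable_weight f ν).mul_const _), integral_const,
    integral_mul_const, probReal_univ, one_smul]

/-- If the mean is a median, a college of at least as large expected utility is weakly preferred
with probability at least `1 / 2`. -/
theorem half_le_prWeakly (hF : Fintype.card F = 2) {f : F} {ν : WeightDist F}
    (h : IsMedian f ν (meanWeight f ν)) {u : Utility M F} {c c' : M}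
    (hc : expectedUtil u ν c' ≤ expectedUtil u ν c) : 1 / 2 ≤ prWeakly u ν c c' := by
  obtain ⟨α, β, h1, h2⟩ := exists_affine hF f u
  rw [h2, h2] at hc
  refine (h.half_le_Pr_affine (A := α c - α c') (B := β c - β c') (by linarith)).trans
    (Pr_mono ν fun w hw => ?_)
  simp only [Set.mem_ofPred_eq, h1] at hw ⊢
  linarith

/-- If the mean is the unique median, a college of smaller expected utility is weakly preferred with
probability less than `1 / 2`. -/
theorem prWeakly_lt_half (hF : Fintype.card F = 2) {f : F} {ν : WeightDist F}
    (h : ∀ m, IsMedian f ν m ↔ m = meanWeight f ν) {u : Utility M F} {c c' : M}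
    (hc : expectedUtil u ν c' < expectedUtil u ν c) : prWeakly u ν c' c < 1 / 2 := by
  obtain ⟨α, β, h1, h2⟩ := exists_affine hF f u
  rw [h2, h2] at hc
  refine lt_of_le_of_lt (Pr_mono ν fun w hw => ?_)
    (Pr_affine_lt_half h (A := α c - α c') (B := β c - β c') (by linarith))
  simp only [Set.mem_ofPred_eq, h1] at hw ⊢
  linarith

theorem measurable_weightedUtil (u : Utility M F) (c : M) :
    Measurable fun w => weightedUtil u w c :=
  Finset.measurable_sum _ fun f _ => (measurable_weight f).mul_const _

end Weights

/-! ### Mean equal to a median implies IC-R -/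

section Sufficiency

variable {N M F : Type*} [Fintype N] [Fintype M] [Fintype F]

omit [Fintype N] in
theorem IsHEUF.nonRepeating {next : NextFn N M F} (h : IsHEUF next) : NonRepeating next :=
  fun s R u ν hR => (h s R u ν hR).1

omit [Fintype N] in
theorem IsHEUF.expectedUtil_le {next : NextFn N M F} (h : IsHEUF next) (I : Market N M F) {s : N}
    {c d : M} (hcd : proposalRank I next s c ≤ proposalRank I next s d) :
    expectedUtil (I.util s) (I.weights s) d ≤ expectedUtil (I.util s) (I.weights s) c := by
  have hn : ∀ R, R ≠ Finset.univ → next s R (I.util s) (I.weights s) ∉ R :=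
    fun R hR => h.nonRepeating s R _ _ hR
  set f := fun R => next s R (I.util s) (I.weights s) with hf
  have hd : d ∉ chain f (rank f c) := by
    rw [mem_chain_iff f hn, not_lt]
    exact hcd
  have h1 := (h s (chain f (rank f c)) (I.util s) (I.weights s)
    fun hu => hd (hu ▸ Finset.mem_univ d)).2 d hd
  have h2 : next s (chain f (rank f c)) (I.util s) (I.weights s) = c := apply_chain_rank f hn c
  rwa [h2] at h1

theorem icrOn_of_isMedian (hF : Fintype.card F = 2) (f : F) {μ : N → WeightDist F}
    {next : NextFn N M F} (h : IsHEUF next) (hμ : ∀ s, IsMedian f (μ s) (meanWeight f (μ s))) :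
    ICROn (withWeights μ) (gda next) := by
  rintro I rfl s u' ν'
  rw [not_lt]
  have hn := h.nonRepeating
  rcases hc : gda next (I.misreport s u' ν') s with _ | c
  · simp only [Better]
    simp [Pr]
  · have hcr := not_rejected_of_misreport hn s u' ν' hc
    rcases hd : gda next I s with _ | d
    · exact (run_not_active I next hn ⟨s, hd, fun hu => hcr (hu ▸ Finset.mem_univ c)⟩).elim
    · obtain ⟨k, hk, hk'⟩ := (valid_run (I := I) hn (Fintype.card N * Fintype.card M)).segment s
      rw [hk, not_lt, ← hk' d hd] at hcr
      have h1 := half_le_prWeakly hF (hμ s) (h.expectedUtil_le I hcr)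
      -- A strict preference for `c` is the complement of a weak preference for `d`.
      have h2 := Pr_not (I.weights s) (measurableSet_le
        (measurable_weightedUtil (I.util s) c) (measurable_weightedUtil (I.util s) d))
      simp only [not_le] at h2
      simp only [Better]
      rw [h2]
      rw [prWeakly] at h1
      linarith

end Sufficiency

/-! ### IC-R implies mean equal to a median -/

section Necessity

variable {N M F : Type*} [Fintype N] [Fintype M] [Fintype F]

/-- If every college can hold all students, each student is assigned her first proposal. -/
theorem gda_of_card_le_cap [Nonempty M] {I : Market N M F} {next : NextFn N M F}
    (hcap : ∀ c, Fintype.card N ≤ I.cap c) (s : N) :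
    gda next I s = some (next s ∅ (I.util s) (I.weights s)) := by
  classical
  have hkeep : ∀ st c x, target I next st x = some c → Keeps I next st c x := by
    intro st c x hx
    refine ⟨hx, lt_of_lt_of_le ?_ (hcap c)⟩
    refine Finset.card_lt_univ_of_notMem (x := x) fun h => ?_
    have := I.prefers_strict c
    exact irrefl_of (I.prefers c) x (Finset.mem_filter.1 h).2.2
  have h1 : ∀ x, (run I next 1).assign x = some (next x ∅ (I.util x) (I.weights x)) := by
    intro x
    have : (∅ : Finset M) ≠ Finset.univ := Finset.univ_nonempty.ne_empty.symm
    have hact : Active (run I next 0) := ⟨x, rfl, this⟩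
    rw [run, if_pos hact, round_assign]
    refine hkeep _ _ _ ?_
    simp [target, run, start, proposal, this]
  have h2 : ∀ k, run I next (k + 1) = run I next 1 := by
    intro k
    induction k with
    | zero => rfl
    | succ k ih =>
      rw [run, if_neg, ih]
      rintro ⟨x, hx, -⟩
      rw [ih, h1] at hx
      cases hx
  obtain ⟨k, hk⟩ : ∃ k, Fintype.card N * Fintype.card M = k + 1 :=
    Nat.exists_eq_succ_of_ne_zero (Nat.mul_pos (Fintype.card_pos_iff.2 ⟨s⟩) Fintype.card_pos).ne'
  rw [gda, hk, h2, h1]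

theorem exists_strictTotalOrder (N : Type*) : ∃ lt : N → N → Prop, IsStrictTotalOrder N lt :=
  ⟨WellOrderingRel, inferInstance⟩

/-- Continuity of the measure from below along `e - 1 / (n + 1)`. The gap between `z` and `e` makes
the truthful choice strict, whatever the tie-breaking. -/
theorem exists_lt_Pr_lt {ν : WeightDist F} {f : F} {e p : ℝ} (h : p < Pr ν {w | w.1 f < e}) :
    ∃ z < e, p < Pr ν {w | w.1 f < z} := by
  have hmono : Monotone fun n : ℕ => {w : WeightVec F | w.1 f < e - 1 / ((n : ℝ) + 1)} :=
    fun n m hnm w hw => lt_of_lt_of_le hw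
      (sub_le_sub_left (Nat.one_div_le_one_div hnm) e)
  have hU : ⋃ n : ℕ, {w : WeightVec F | w.1 f < e - 1 / ((n : ℝ) + 1)} = {w | w.1 f < e} := by
    ext w
    simp only [Set.mem_iUnion, Set.mem_ofPred_eq]
    refine ⟨fun ⟨n, hn⟩ => hn.trans (sub_lt_self e Nat.one_div_pos_of_nat), fun hw => ?_⟩
    obtain ⟨n, hn⟩ := exists_nat_one_div_lt (sub_pos.2 hw)
    exact ⟨n, by linarith⟩
  have ht := tendsto_measure_iUnion_atTop (μ := (ν : Measure (WeightVec F))) hmono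
  rw [hU] at ht
  have ht' := (ENNReal.tendsto_toReal (measure_ne_top _ _)).comp ht
  obtain ⟨n, hn⟩ := (ht'.eventually_const_lt h).exists
  exact ⟨_, sub_lt_self e Nat.one_div_pos_of_nat, hn⟩

theorem half_le_Pr_of_icrOn (f : F) {μ : N → WeightDist F} {next : NextFn N M F}
    (h : IsHEUF next) (hM : 2 ≤ Fintype.card M) (hic : ICROn (withWeights μ) (gda next)) (s : N) :
    1 / 2 ≤ Pr (μ s) {w | meanWeight f (μ s) ≤ w.1 f} := by
  classical
  by_contra hlt
  have h1 := Pr_lt (μ s) (measurable_weight f) (meanWeight f (μ s))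
  obtain ⟨z, hz, hzPr⟩ := exists_lt_Pr_lt (ν := μ s) (f := f) (e := meanWeight f (μ s))
    (p := 1 / 2) (by linarith)
  have hz0 : 0 < z := by
    by_contra hz0
    have : {w : WeightVec F | w.1 f < z} = ∅ := Set.eq_empty_of_forall_notMem fun w hw =>
      hz0 ((weight_nonneg f w).trans_lt hw)
    rw [this, Pr, measureReal_empty] at hzPr
    norm_num at hzPr
  have he1 : meanWeight f (μ s) ≤ 1 := by
    have := integral_mono (integrable_weight f (μ s)) (integrable_const (1 : ℝ)) (weight_le_one f)
    simpa [meanWeight] using this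
  obtain ⟨c, d, hcd⟩ := Fintype.exists_pair_of_one_lt_card hM
  have hne : Nonempty M := ⟨c⟩
  obtain ⟨lt, hlt'⟩ := exists_strictTotalOrder N
  set z' : Set.Icc (0 : ℝ) 1 := ⟨z, hz0.le, hz.le.trans he1⟩
  -- College `c` is worth the weight of `f`, college `d` constantly `z`, all others 0. As `0 < z`
  -- and `z` is below the mean, `c` alone maximizes expected utility.
  set u : Utility M F := fun g x => if x = c then (if g = f then 1 else 0) else
    if x = d then z' else 0 with hu
  set u' : Utility M F := fun _ x => if x = d then 1 else 0 with hu'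
  have hwsum : ∀ w : WeightVec F, ∑ g, w.1 g = 1 := fun w => w.2.2
  have huc : ∀ w, weightedUtil u w c = w.1 f := fun w => by
    simp [weightedUtil, hu, apply_ite ((↑) : Set.Icc (0 : ℝ) 1 → ℝ)]
  have hud : ∀ w, weightedUtil u w d = z := fun w => by
    simp [weightedUtil, hu, hcd.symm, ← Finset.sum_mul, hwsum, z']
  have hux : ∀ w x, x ≠ c → x ≠ d → weightedUtil u w x = 0 := fun w x hx hx' => by
    simp [weightedUtil, hu, hx, hx']
  have hud' : ∀ w, weightedUtil u' w d = 1 := fun w => by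
    simp [weightedUtil, hu', hwsum]
  have hux' : ∀ w x, x ≠ d → weightedUtil u' w x = 0 := fun w x hx => by
    simp [weightedUtil, hu', hx]
  let I : Market N M F :=
    { cap := fun _ => Fintype.card N
      cap_pos := fun _ => Fintype.card_pos_iff.2 ⟨s⟩
      prefers := fun _ => lt
      prefers_strict := fun _ => hlt'
      util := fun _ => u
      weights := μ }
  have huniv : (∅ : Finset M) ≠ Finset.univ := Finset.univ_nonempty.ne_empty.symm
  have htruth : next s ∅ u (μ s) = c := by
    by_contra hx
    have h2 := (h s ∅ u (μ s) huniv).2 c (Finset.notMem_empty c)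
    simp only [expectedUtil, huc] at h2
    rw [← meanWeight] at h2
    by_cases hx' : next s ∅ u (μ s) = d
    · simp only [hx', hud, integral_const, probReal_univ, one_smul] at h2
      linarith
    · simp only [hux _ _ hx hx', integral_zero] at h2
      linarith
  have hlie : next s ∅ u' (μ s) = d := by
    by_contra hx
    have h2 := (h s ∅ u' (μ s) huniv).2 d (Finset.notMem_empty d)
    simp only [expectedUtil, hud', hux' _ _ hx, integral_const, probReal_univ,
      one_smul] at h2
    linarith
  refine hic I rfl s u' (μ s) ?_
  have e1 : gda next I s = some c := by
    rw [gda_of_card_le_cap (I := I) fun _ => le_rfl]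
    exact congrArg some htruth
  have e2 : gda next (I.misreport s u' (μ s)) s = some d := by
    rw [gda_of_card_le_cap (I := I.misreport s u' (μ s)) fun _ => le_rfl]
    simpa [Market.misreport] using hlie
  rw [e1, e2]
  have e3 : {w | Better (I.util s) w (some d) (some c)} = {w : WeightVec F | w.1 f < z} := by
    ext w
    change weightedUtil u w c < weightedUtil u w d ↔ _
    rw [huc, hud]
    rfl
  rw [e3]
  exact hzPr

theorem isMedian_of_icrOn (hF : Fintype.card F = 2) (f : F) {μ : N → WeightDist F}
    {next : NextFn N M F} (h : IsHEUF next) (hM : 2 ≤ Fintype.card M)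
    (hic : ICROn (withWeights μ) (gda next)) (s : N) :
    IsMedian f (μ s) (meanWeight f (μ s)) := by
  refine ⟨half_le_Pr_of_icrOn f h hM hic s, ?_⟩
  -- The same bound for the other feature, whose weight is one minus that of `f`, gives the reversed
  -- inequality.
  obtain ⟨g, -, hsum⟩ := exists_other_feature hF f
  have hw : ∀ w : WeightVec F, w.1 g = 1 - w.1 f := fun w => by
    have := w.2.2
    rw [hsum] at this
    linarith
  have hm : meanWeight g (μ s) = 1 - meanWeight f (μ s) := by
    simp only [meanWeight, hw]
    rw [integral_sub (integrable_const _) (integrable_weight f (μ s))]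
    simp
  refine (half_le_Pr_of_icrOn g h hM hic s).trans (Pr_mono _ fun w h => ?_)
  simp only [Set.mem_ofPred_eq, hw, hm] at h ⊢
  linarith

end Necessity

/-! ### Comparison of LOICV with HEUF -/

section ComparisonVectors

variable {N M F : Type*} [Fintype N] [Fintype M] [Fintype F]

theorem prWeakly_mem_comparisonVec {u : Utility M F} {ν : WeightDist F} {R : Finset M} {c c' : M}
    (hc' : c' ∉ R) (h : c' ≠ c) : prWeakly u ν c c' ∈ comparisonVec u ν R c := by
  classical
  rw [comparisonVec, Multiset.mem_sort]
  exact Multiset.mem_map_of_mem _ (Finset.mem_def.1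
    (Finset.mem_erase.2 ⟨h, Finset.mem_sdiff.2 ⟨Finset.mem_univ c', hc'⟩⟩))

theorem exists_of_mem_comparisonVec {u : Utility M F} {ν : WeightDist F} {R : Finset M} {c : M}
    {x : ℝ} (hx : x ∈ comparisonVec u ν R c) : ∃ c' ∉ R, prWeakly u ν c c' = x := by
  classical
  rw [comparisonVec, Multiset.mem_sort] at hx
  obtain ⟨c', hc', rfl⟩ := Multiset.mem_map.1 hx
  exact ⟨c', (Finset.mem_sdiff.1 (Finset.mem_of_mem_erase (Finset.mem_def.2 hc'))).2, rfl⟩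

/-- If the mean is the unique median, a college with a largest iterated comparison vector has the
largest expected utility. -/
theorem expectedUtil_le_of_not_comparisonVec_lt (hF : Fintype.card F = 2) {f : F}
    {ν : WeightDist F} (h : ∀ m, IsMedian f ν m ↔ m = meanWeight f ν) {u : Utility M F}
    {R : Finset M} {d : M} (hd : d ∉ R)
    (hmax : ∀ c, c ∉ R → ¬ comparisonVec u ν R d < comparisonVec u ν R c) (c : M) (hc : c ∉ R) :
    expectedUtil u ν c ≤ expectedUtil u ν d := by
  classical
  obtain ⟨m, hm, hmle⟩ := Finset.exists_max_image (Finset.univ \ R) (expectedUtil u ν)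
    ⟨d, by simpa using hd⟩
  replace hm : m ∉ R := by simpa using hm
  replace hmle : ∀ x, x ∉ R → expectedUtil u ν x ≤ expectedUtil u ν m :=
    fun x hx => hmle x (by simpa using hx)
  refine (hmle c hc).trans ?_
  by_contra hlt
  rw [not_le] at hlt
  have hdm : d ≠ m := fun hdm => hlt.ne (hdm ▸ rfl)
  refine hmax m hm ?_
  have h1 := prWeakly_mem_comparisonVec (u := u) (ν := ν) hm hdm.symm
  have h2 := prWeakly_mem_comparisonVec (u := u) (ν := ν) hd hdm
  have h3 : (comparisonVec u ν R d).Pairwise (· ≤ ·) := Multiset.pairwise_sort _ _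
  have h4 := fun x => exists_of_mem_comparisonVec (u := u) (ν := ν) (R := R) (c := m) (x := x)
  generalize comparisonVec u ν R d = v at h1 h3
  generalize comparisonVec u ν R m = v' at h2 h4
  cases v with
  | nil => simp at h1
  | cons a l =>
    cases v' with
    | nil => simp at h2
    | cons b l' =>
      -- The heads decide: that of `d` is at most its probability against `m`, below 1/2, while
      -- every entry of `m` is at least 1/2.
      refine List.cons_lt_cons_iff.2 (Or.inl ?_)
      obtain ⟨x, hx, rfl⟩ := h4 b List.mem_cons_self
      refine lt_of_lt_of_le ?_ (half_le_prWeakly hF ((h _).2 rfl) (hmle x hx))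
      refine lt_of_le_of_lt ?_ (prWeakly_lt_half hF h hlt)
      rcases List.mem_cons.1 h1 with h1 | h1
      exacts [h1.ge, (List.pairwise_cons.1 h3).1 _ h1]

/-- The outcome depends only on the proposals for the utilities and weights of the market. -/
theorem gda_congr {I : Market N M F} {next next' : NextFn N M F}
    (h : ∀ s R, R ≠ Finset.univ →
      next s R (I.util s) (I.weights s) = next' s R (I.util s) (I.weights s)) :
    gda next I = gda next' I := by
  have hp : ∀ st, target I next st = target I next' st := by
    intro st
    funext s
    simp only [target, proposal]
    congr 1
    funext _
    split_ifs with hs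
    exacts [congrArg some (h s _ hs.2), rfl]
  have hr : ∀ st, round I next st = round I next' st := by
    intro st
    unfold round Keeps
    rw [hp]
  have : ∀ k, run I next k = run I next' k := by
    intro k
    induction k with
    | zero => rfl
    | succ k ih => rw [run, run, ih, hr]
  rw [gda, gda, this]

end ComparisonVectors

end SchoolChoice

/-! ### Assembly of the main theorem -/

open SchoolChoice in
theorem mainTheorem5 {N M F : Type*} [Fintype N] [Fintype M] [Fintype F]
    (hF : Fintype.card F = 2) (f₁ : F) (μ : N → WeightDist F)
    (next : NextFn N M F) (hnext : IsHEUF next) :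
    -- the characterization, when no mean carries an atom (at least two colleges for necessity)
    ((∀ s, Pr (μ s) {w | w.1 f₁ = meanWeight f₁ (μ s)} = 0) → 2 ≤ Fintype.card M →
      (ICROn (withWeights μ) (gda next) ↔ ∀ s, Balanced f₁ (μ s))) ∧
    -- sufficiency for arbitrary distributions
    ((∀ s, Balanced f₁ (μ s)) → ICROn (withWeights μ) (gda next)) ∧
    -- the characterization for arbitrary distributions
    (2 ≤ Fintype.card M →
      (ICROn (withWeights μ) (gda next) ↔ ∀ s, IsMedian f₁ (μ s) (meanWeight f₁ (μ s)))) ∧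
    -- agreement with LOICV, up to tie-breaking
    ((∀ s m, IsMedian f₁ (μ s) m ↔ m = meanWeight f₁ (μ s)) →
      ∀ loicv : NextFn N M F, IsLOICV loicv →
        (∃ heuf : NextFn N M F, IsHEUF heuf ∧
          (∀ s R u, heuf s R u (μ s) = loicv s R u (μ s)) ∧
          ∀ I ∈ withWeights μ, gda loicv I = gda heuf I) ∧
        (∀ I ∈ withWeights μ, (∀ s, Function.Injective (expectedUtil (I.util s) (μ s))) →
          gda next I = gda loicv I)) := by
  classical
  have hmed : 2 ≤ Fintype.card M →
      (ICROn (withWeights μ) (gda next) ↔ ∀ s, IsMedian f₁ (μ s) (meanWeight f₁ (μ s))) :=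
    fun hM => ⟨fun h s => isMedian_of_icrOn hF f₁ hnext hM h s,
      fun h => icrOn_of_isMedian hF f₁ hnext h⟩
  refine ⟨fun h0 hM => (hmed hM).trans (forall_congr' fun s => ⟨fun h => h.balanced (h0 s),
    fun h => h.isMedian⟩), fun h => icrOn_of_isMedian hF f₁ hnext fun s => (h s).isMedian, hmed,
    fun huniq loicv hloicv => ?_⟩
  have hlo : ∀ s R u, R ≠ Finset.univ → loicv s R u (μ s) ∉ R ∧
      ∀ c, c ∉ R → expectedUtil u (μ s) c ≤ expectedUtil u (μ s) (loicv s R u (μ s)) := by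
    intro s R u hR
    obtain ⟨h1, h2⟩ := hloicv s R u (μ s) hR
    exact ⟨h1, expectedUtil_le_of_not_comparisonVec_lt hF (huniq s) h1 h2⟩
  -- The LOICV rule is known to maximize expected utility only for the distributions `μ s`;
  -- elsewhere the given HEUF rule takes over.
  refine ⟨⟨fun s R u ν => if ν = μ s then loicv s R u ν else next s R u ν, fun s R u ν hR => ?_,
    fun s R u => if_pos rfl, ?_⟩, ?_⟩
  · by_cases hν : ν = μ s
    · subst hν
      simpa only [if_true] using hlo s R u hR
    · simpa only [hν, if_false] using hnext s R u ν hR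
  · rintro I rfl
    exact gda_congr fun s R _ => (if_pos rfl).symm
  · rintro I rfl hinj
    refine gda_congr fun s R hR => hinj s (le_antisymm ?_ ?_)
    · exact (hlo s R _ hR).2 _ (hnext s R _ _ hR).1
    · exact (hnext s R _ _ hR).2 _ (hlo s R _ hR).1
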